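/- A subset of $\mathbb R^m$ is called semialgebraic if it is a finite union of sets, each of which is defined by finitely many polynomial equations $p=0$ and finitely many strict polynomial inequalities $q>0$ with real coefficients. A mapping $Y:\mathbb R^n\to\mathbb R^n$ is called semialgebraic if its graph is a semialgebraic subset of $\mathbb R^n\times\mathbb R^n=\mathbb R^{2n}$. If $Y:\mathbb R^n\to\mathbb R^n$ is a semialgebraic local homeomorphism, then there exists $k\in\mathbb N$ such that every fiber is finite with at most $k$ points: $\#Y^{-1}(q)\le k$ for all $q\in\mathbb R^n$. -/

import Mathlib

/-- A subset of `ℝ^σ` is semialgebraic if it is a finite union of sets, each of which is the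
solution set of finitely many polynomial equations `p = 0` and strict polynomial inequalities
`0 < q` with real coefficients. Here `F` is the finite family of systems; a system `b` consists of
its finite set of equations `b.1` and its finite set of strict inequalities `b.2`. -/
def IsSemialgebraic {σ : Type*} (S : Set (σ → ℝ)) : Prop :=
  ∃ F : Finset (Finset (MvPolynomial σ ℝ) × Finset (MvPolynomial σ ℝ)),
    S = {x | ∃ b ∈ F, (∀ p ∈ b.1, MvPolynomial.eval x p = 0) ∧
      ∀ q ∈ b.2, 0 < MvPolynomial.eval x q}

/-- A mapping `Y : ℝ^σ → ℝ^τ` is semialgebraic if its graph is a semialgebraic subset of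
`ℝ^σ × ℝ^τ`. The product is written as `ℝ^(σ ⊕ τ)`: a point `z` of it stands for the pair of its
restrictions `z ∘ Sum.inl` and `z ∘ Sum.inr`. -/
def IsSemialgebraicMap {σ τ : Type*} (Y : (σ → ℝ) → (τ → ℝ)) : Prop :=
  IsSemialgebraic {z : σ ⊕ τ → ℝ | Y (z ∘ Sum.inl) = z ∘ Sum.inr}

/-!
# Uniform bounds for the fibers of semialgebraic local homeomorphisms

The points of a fiber of a local homeomorphism are isolated in the fiber. The fiber over `q` is
obtained by substituting `q` into the finitely many polynomial systems that define the graph, which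
does not raise total degrees. So it suffices to bound the number of isolated points of the solution
set of a system `p = 0` (`p ∈ A`), `0 < r` (`r ∈ B`) in terms of the degrees of the equations alone
(`encard_isolated_le`). The inequalities are open conditions, so such a point is an isolated zero of
the nonnegative polynomial `∑ p ∈ A, p ^ 2`.

The isolated zeros of a nonnegative polynomial `P` with `deg P + 1 < 2 * D` number at most
`(2 * D - 1) ^ n` (`card_isolated_zeros_le`). Indeed, for small `ε > 0` the perturbation
`P + ε * ∑ i, X i ^ (2 * D)` still has a local minimum near each of finitely many prescribed
isolated zeros of `P`. At a local minimum the partial derivatives vanish, and these have the form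
`2 * D * ε * X i ^ (2 * D - 1)` plus terms of lower degree. Modulo such a system every polynomial
reduces to a combination of the monomials with all exponents below `2 * D - 1`. By interpolation,
polynomials realize every function on a finite set, so a finite set of common zeros has at most as
many points as there are such monomials (`card_le_of_pow_eq_lower_degree`). The perturbation is what
makes this count elementary: no genericity of the critical points and no form of Bézout's theorem
are needed.
-/

open MvPolynomial Filter Topology

/-! ### Counting common zeros of systems with pure leading powers -/

/-- Interpolation: on a finite set of points, every function is given by a polynomial. -/
theorem exists_eval_eq_on_finset {σ K : Type*} [Field K] (Z : Finset (σ → K)) (f : Z → K) :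
    ∃ p : MvPolynomial σ K, ∀ z : Z, eval (z : σ → K) p = f z := by
  classical
  have key : ∀ z w : σ → K, ∃ p : MvPolynomial σ K,
      eval z p = 1 ∧ (w ≠ z → eval w p = 0) := by
    intro z w
    by_cases h : w = z
    · exact ⟨1, by simp, fun h' => absurd h h'⟩
    · obtain ⟨i, hi⟩ := Function.ne_iff.mp h
      refine ⟨C (z i - w i)⁻¹ * (X i - C (w i)), ?_, fun _ => by simp⟩
      have : z i - w i ≠ 0 := sub_ne_zero.mpr (Ne.symm hi)
      simp [this]
  choose p hp1 hp0 using key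
  refine ⟨∑ z : Z, C (f z) * ∏ w ∈ Z, p z w, fun z => ?_⟩
  rw [map_sum, Finset.sum_eq_single z]
  · simp [map_prod, hp1]
  · intro z' _ hne
    rw [map_mul, map_prod, Finset.prod_eq_zero z.2, mul_zero]
    exact hp0 _ _ fun h => hne (Subtype.ext h.symm)
  · simp

/-- If on a finite set of points each power `x i ^ m` agrees with a polynomial of degree less than
`m`, then every monomial function on it is a combination of monomials with exponents below `m`, so
that there are at most `m ^ n` points. -/
theorem card_le_of_pow_eq_lower_degree {σ K : Type*} [Fintype σ] [Field K] {m : ℕ}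
    (r : σ → MvPolynomial σ K) (hr : ∀ i, (r i).totalDegree < m) (Z : Finset (σ → K))
    (hZ : ∀ z ∈ Z, ∀ i, z i ^ m = eval z (r i)) :
    Z.card ≤ m ^ Fintype.card σ := by
  classical
  let φ : MvPolynomial σ K →ₗ[K] (Z → K) :=
    LinearMap.pi fun z => (aeval (R := K) (z : σ → K)).toLinearMap
  have hφ : ∀ p z, φ p z = eval (z : σ → K) p := fun p z => by
    simp [φ, aeval_eq_eval]
  let b : (σ → Fin m) → (Z → K) := fun e z => ∏ i, (z : σ → K) i ^ (e i : ℕ)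
  let V := Submodule.span K (Set.range b)
  have hmon : ∀ d : ℕ, ∀ s : σ →₀ ℕ, s.degree = d → φ (monomial s 1) ∈ V := by
    intro d
    induction d using Nat.strong_induction_on with
    | _ d ih =>
    intro s hs
    by_cases hlt : ∀ i, s i < m
    · refine Submodule.subset_span ⟨fun i => ⟨s i, hlt i⟩, ?_⟩
      ext z
      rw [hφ, eval_monomial, one_mul, Finsupp.prod_fintype _ _ (by simp)]
    · push Not at hlt
      obtain ⟨i, hi⟩ := hlt
      have hsplit : s = Finsupp.single i m + (s - Finsupp.single i m) := by
        rw [add_tsub_cancel_of_le]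
        simpa using hi
      set s' := s - Finsupp.single i m with hs'
      have hdeg : m + s'.degree = d := by
        rw [← hs, hsplit, map_add, Finsupp.degree_single]
      have hrepl : φ (monomial s 1) = φ (r i * monomial s' 1) := by
        ext z
        rw [hφ, hφ, hsplit, map_mul, ← hZ z z.2 i, eval_monomial, eval_monomial,
          Finsupp.prod_add_index' (by simp) (by intro a b c; exact pow_add _ _ _)]
        simp
      rw [hrepl, (r i).as_sum, Finset.sum_mul, map_sum]
      refine Submodule.sum_mem _ fun t ht => ?_
      rw [monomial_mul, mul_one, ← mul_one (coeff t (r i)), ← smul_eq_mul, ← smul_monomial,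
        map_smul]
      refine Submodule.smul_mem _ _ (ih (t + s').degree ?_ _ rfl)
      have h1 : t.degree ≤ (r i).totalDegree := le_totalDegree ht
      have h2 := hr i
      rw [map_add]
      omega
  have hV : V = ⊤ := by
    refine eq_top_iff.mpr fun f _ => ?_
    obtain ⟨p, hp⟩ := exists_eval_eq_on_finset Z f
    have hfp : f = φ p := funext fun z => by rw [hφ, hp]
    rw [hfp, p.as_sum, map_sum]
    refine Submodule.sum_mem _ fun t _ => ?_
    rw [← mul_one (coeff t p), ← smul_eq_mul, ← smul_monomial, map_smul]
    exact Submodule.smul_mem _ _ (hmon _ t rfl)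
  have h := finrank_range_le_card (R := K) b
  rw [Set.finrank, show Submodule.span K (Set.range b) = ⊤ from hV, finrank_top] at h
  simpa using h

/-! ### Degrees of derivatives and of substitutions -/

theorem totalDegree_pderiv_le {σ R : Type*} [CommSemiring R] (i : σ) (p : MvPolynomial σ R) :
    (pderiv i p).totalDegree ≤ p.totalDegree := by
  classical
  conv_lhs => rw [p.as_sum, map_sum]
  refine totalDegree_finsetSum_le fun s hs => ?_
  rw [pderiv_monomial]
  refine (totalDegree_monomial_le _ _).trans (le_trans ?_ (le_totalDegree hs))
  exact Finsupp.degree_mono tsub_le_self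

/-- Substituting polynomials of degree at most `1` does not raise the total degree. -/
theorem totalDegree_aeval_le_of_totalDegree_le_one {σ τ R : Type*} [CommSemiring R]
    (f : σ → MvPolynomial τ R) (hf : ∀ i, (f i).totalDegree ≤ 1) (p : MvPolynomial σ R) :
    (aeval f p).totalDegree ≤ p.totalDegree := by
  conv_lhs => rw [p.as_sum, map_sum]
  refine totalDegree_finsetSum_le fun s hs => ?_
  rw [aeval_monomial, algebraMap_eq]
  refine (totalDegree_mul _ _).trans ?_
  rw [totalDegree_C, zero_add]
  refine (totalDegree_finsetProd _ _).trans (le_trans ?_ (le_totalDegree hs))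
  refine Finset.sum_le_sum fun i _ => (totalDegree_pow _ _).trans ?_
  simpa using Nat.mul_le_mul_left (s i) (hf i)

/-! ### Critical points -/

theorem hasDerivAt_eval_update {σ : Type*} [DecidableEq σ] (p : MvPolynomial σ ℝ) (z : σ → ℝ)
    (i : σ) : HasDerivAt (fun t => eval (Function.update z i t) p) (eval z (pderiv i p)) (z i) := by
  induction p using MvPolynomial.induction_on with
  | C a => simpa using hasDerivAt_const (z i) a
  | add p q hp hq =>
    simp only [map_add]
    exact hp.fun_add hq
  | mul_X p j hp =>
    have hX : HasDerivAt (fun t => Function.update z i t j) (eval z (pderiv i (X j))) (z i) := by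
      by_cases h : j = i
      · subst h
        simpa using hasDerivAt_id' (z j)
      · simpa [Function.update_of_ne h, pderiv_X_of_ne h] using hasDerivAt_const (z i) (z j)
    have := hp.fun_mul hX
    simp only [Function.update_eq_self] at this
    simpa [pderiv_mul, mul_comm, add_comm] using this

theorem eval_pderiv_eq_zero_of_isLocalMin {σ : Type*} {p : MvPolynomial σ ℝ} {z : σ → ℝ}
    (h : IsLocalMin (fun x => eval x p) z) (i : σ) : eval z (pderiv i p) = 0 := by
  classical
  refine IsLocalMin.hasDerivAt_eq_zero (f := fun t => eval (Function.update z i t) p) (a := z i)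
    ?_ (hasDerivAt_eval_update p z i)
  have hc : ContinuousAt (fun t : ℝ => Function.update z i t) (z i) := by fun_prop
  have h' : ∀ᶠ x in 𝓝 (Function.update z i (z i)), eval z p ≤ eval x p := by
    rw [Function.update_eq_self]
    exact h
  simpa [IsLocalMin, IsMinFilter] using hc.eventually h'

/-! ### Isolated zeros -/

/-- If `x` is the only zero of the continuous function `f ≥ 0` in a neighbourhood `U` of `x`, then
for all sufficiently small `ε > 0` the function `f + ε * g` has a local minimum in `U`. -/
theorem eventually_exists_isLocalMin_add_mul {E : Type*} [MetricSpace E] [ProperSpace E]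
    {f g : E → ℝ} (hf : Continuous f) (hg : Continuous g) (hf0 : ∀ y, 0 ≤ f y)
    (hg0 : ∀ y, 0 ≤ g y) {x : E} (hx : f x = 0) {U : Set E} (hU : U ∈ 𝓝 x)
    (hiso : ∀ y ∈ U, f y = 0 → y = x) :
    ∀ᶠ ε in 𝓝[>] (0 : ℝ), ∃ y ∈ U, IsLocalMin (fun y => f y + ε * g y) y := by
  obtain ⟨r, hr, hrU⟩ := Metric.nhds_basis_closedBall.mem_iff.mp hU
  obtain ⟨δ, hδ, hδf⟩ := (isCompact_sphere x r).exists_forall_le' (a := 0) hf.continuousOn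
    fun y hy => (hf0 y).lt_of_ne' fun h => by
      have := hiso y (hrU (Metric.sphere_subset_closedBall hy)) h
      subst this
      simp [hr.ne] at hy
  have hsmall : ∀ᶠ ε in 𝓝[>] (0 : ℝ), ε * g x < δ := by
    have : Tendsto (fun ε : ℝ => ε * g x) (𝓝 0) (𝓝 (0 * g x)) :=
      (continuous_id.mul continuous_const).tendsto 0
    rw [zero_mul] at this
    exact (this.mono_left nhdsWithin_le_nhds).eventually (gt_mem_nhds hδ)
  filter_upwards [hsmall, self_mem_nhdsWithin] with ε hε hpos
  have hcont : Continuous fun y => f y + ε * g y := by fun_prop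
  obtain ⟨y, hy, hmin⟩ := (isCompact_closedBall x r).exists_isLocalMin_mem_open
    (z := x) Metric.ball_subset_closedBall hcont.continuousOn
    (Metric.mem_closedBall_self hr.le) (by
      intro y hy
      have hy' : y ∈ Metric.sphere x r := by
        rwa [Metric.closedBall_sdiff_ball] at hy
      have h1 := hδf y hy'
      have h2 := mul_nonneg (le_of_lt hpos) (hg0 y)
      simp only [hx]
      linarith) Metric.isOpen_ball
  exact ⟨y, hrU (Metric.ball_subset_closedBall hy), hmin⟩

/-- A nonnegative polynomial has boundedly many isolated zeros, with a bound that depends only on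
its degree and the number of variables. -/
theorem card_isolated_zeros_le {σ : Type*} [Fintype σ] (P : MvPolynomial σ ℝ)
    (hP : ∀ x, 0 ≤ eval x P) {D : ℕ} (hD : P.totalDegree + 1 < 2 * D) (T : Finset (σ → ℝ))
    (hT : ∀ x ∈ T, eval x P = 0 ∧ ∀ᶠ y in 𝓝 x, eval y P = 0 → y = x) :
    T.card ≤ (2 * D - 1) ^ Fintype.card σ := by
  classical
  let H : MvPolynomial σ ℝ := ∑ i, X i ^ (2 * D)
  have hH0 : ∀ y, 0 ≤ eval y H := fun y => by
    simp only [H, map_sum, map_pow, eval_X]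
    exact Finset.sum_nonneg fun i _ => (even_two_mul D).pow_nonneg _
  obtain ⟨U, hU, hdisj⟩ := T.finite_toSet.t2_separation
  have hev : ∀ᶠ ε in 𝓝[>] (0 : ℝ), ∀ x ∈ T,
      ∃ y ∈ U x, IsLocalMin (fun y => eval y P + ε * eval y H) y := by
    refine (Filter.eventually_all_finset T).mpr fun x hx => ?_
    refine (eventually_exists_isLocalMin_add_mul (U := U x ∩ {y | eval y P = 0 → y = x})
      (continuous_eval P) (continuous_eval H) hP hH0 (hT x hx).1
      (inter_mem ((hU x).2.mem_nhds (hU x).1) (hT x hx).2) fun y hy => hy.2).mono ?_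
    rintro ε ⟨y, hy, hmin⟩
    exact ⟨y, hy.1, hmin⟩
  obtain ⟨ε, hε, hpos⟩ := (hev.and self_mem_nhdsWithin).exists
  have hpos : 0 < ε := hpos
  choose! y hyU hymin using hε
  have hinj : Set.InjOn y T := fun a ha b hb hab => by
    by_contra hne
    exact Set.disjoint_left.mp (hdisj ha hb hne) (hyU a ha) (hab ▸ hyU b hb)
  rw [← Finset.card_image_of_injOn hinj]
  have hD0 : (2 * D : ℝ) * ε ≠ 0 := by
    have : 0 < D := by omega
    positivity
  -- Solving `∂ᵢ(P + ε * H) = 0` for the leading power `X i ^ (2 * D - 1)`.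
  refine card_le_of_pow_eq_lower_degree
    (fun i => C (-((2 * D : ℝ) * ε)⁻¹) * pderiv i P) (fun i => ?_) _ fun z hz i => ?_
  · refine (totalDegree_mul _ _).trans_lt ?_
    have := totalDegree_pderiv_le i P
    rw [totalDegree_C]
    omega
  · obtain ⟨x, hx, rfl⟩ := Finset.mem_image.mp hz
    have hmin : IsLocalMin (fun w => eval w (P + C ε * H)) (y x) := by
      simpa using hymin x hx
    have h0 := eval_pderiv_eq_zero_of_isLocalMin hmin i
    have hH : pderiv i H = C (2 * D : ℝ) * X i ^ (2 * D - 1) := by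
      simp only [H, map_sum, pderiv_pow]
      rw [Finset.sum_eq_single i (fun j _ hj => by rw [pderiv_X_of_ne hj, mul_zero]) (by simp)]
      simp [← map_ofNat (C (σ := σ) (R := ℝ)) 2]
    rw [map_add, pderiv_C_mul, hH] at h0
    simp only [map_add, map_mul, map_pow, eval_C, eval_X] at h0 ⊢
    rw [neg_mul, inv_mul_eq_div, ← neg_div, eq_div_iff hD0]
    linarith

/-- If all points of the solution set of equations `p a = 0` (`a ∈ A`) and strict inequalities
`0 < q b` (`b ∈ B`) are isolated in it, then their number is bounded in terms of the degrees of the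
equations and the number of variables. -/
theorem encard_isolated_le {σ ι : Type*} [Fintype σ] (A B : Finset ι)
    (p q : ι → MvPolynomial σ ℝ) {d : ℕ} (hd : ∀ a ∈ A, (p a).totalDegree ≤ d) {S : Set (σ → ℝ)}
    (hS : S = {x | (∀ a ∈ A, eval x (p a) = 0) ∧ ∀ b ∈ B, 0 < eval x (q b)})
    (hiso : ∀ x ∈ S, ∀ᶠ y in 𝓝 x, y ∈ S → y = x) :
    S.encard ≤ (((2 * (d + 1) - 1) ^ Fintype.card σ : ℕ) : ℕ∞) := by
  let P : MvPolynomial σ ℝ := ∑ a ∈ A, p a ^ 2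
  have hPeval : ∀ x, eval x P = ∑ a ∈ A, eval x (p a) ^ 2 := fun x => by simp [P]
  have hP0 : ∀ x, 0 ≤ eval x P := fun x => by
    rw [hPeval]
    exact Finset.sum_nonneg fun a _ => sq_nonneg _
  have hPzero : ∀ x, eval x P = 0 ↔ ∀ a ∈ A, eval x (p a) = 0 := fun x => by
    rw [hPeval, Finset.sum_eq_zero_iff_of_nonneg fun a _ => sq_nonneg _]
    simp
  have hdeg : P.totalDegree ≤ 2 * d := totalDegree_finsetSum_le fun a ha =>
    (totalDegree_pow _ _).trans (Nat.mul_le_mul_left 2 (hd a ha))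
  have hfin : ∀ T : Finset (σ → ℝ), ↑T ⊆ S → T.card ≤ (2 * (d + 1) - 1) ^ Fintype.card σ := by
    intro T hTS
    refine card_isolated_zeros_le P hP0 (by omega) T fun x hx => ?_
    have hxS := hTS hx
    have hx' := hxS
    rw [hS] at hx'
    refine ⟨(hPzero x).mpr hx'.1, ?_⟩
    have hpos : ∀ᶠ y in 𝓝 x, ∀ b ∈ B, 0 < eval y (q b) :=
      (Filter.eventually_all_finset B).mpr fun b hb =>
        (continuous_eval (q b)).continuousAt.eventually (lt_mem_nhds (hx'.2 b hb))
    filter_upwards [hpos, hiso x hxS] with y hy1 hy2 hy3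
    refine hy2 ?_
    rw [hS]
    exact ⟨(hPzero y).mp hy3, hy1⟩
  by_contra! hlt
  obtain ⟨t, htS, ht⟩ := Set.exists_subset_encard_eq (Order.add_one_le_of_lt hlt)
  have htfin : t.Finite := Set.finite_of_encard_eq_coe (k := _ + 1) (by exact_mod_cast ht)
  have h := hfin htfin.toFinset (by simpa using htS)
  rw [htfin.encard_eq_coe_toFinset_card] at ht
  have ht' : htfin.toFinset.card = (2 * (d + 1) - 1) ^ Fintype.card σ + 1 := by exact_mod_cast ht
  omega

/-! ### Fibers -/

theorem corollary4p2 (n : ℕ) (Y : (Fin n → ℝ) → (Fin n → ℝ))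
    (hsa : IsSemialgebraicMap Y) (hloc : IsLocalHomeomorph Y) :
    ∃ k : ℕ, ∀ q : Fin n → ℝ, (Y ⁻¹' {q}).encard ≤ (k : ℕ∞) := by
  obtain ⟨F, hF⟩ := hsa
  let d : ℕ := F.sup fun b => b.1.sup totalDegree
  refine ⟨F.card * (2 * (d + 1) - 1) ^ n, fun q => ?_⟩
  -- Restriction of a polynomial on `ℝ^n × ℝ^n` to the slice `ℝ^n × {q}`.
  let sub : MvPolynomial (Fin n ⊕ Fin n) ℝ → MvPolynomial (Fin n) ℝ :=
    aeval (Sum.elim X fun j => C (q j))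
  have hsub : ∀ p x, eval x (sub p) = eval (Sum.elim x q) p := fun p x => by
    have h : ((eval x).comp (aeval (R := ℝ) (Sum.elim X fun j => C (q j))).toRingHom) =
        eval (Sum.elim x q) := by
      refine ringHom_ext (fun r => by simp) fun i => ?_
      cases i <;> simp
    exact congrArg (fun f => f p) h
  let S : Finset (MvPolynomial (Fin n ⊕ Fin n) ℝ) × Finset (MvPolynomial (Fin n ⊕ Fin n) ℝ) →
      Set (Fin n → ℝ) :=
    fun b => {x | (∀ p ∈ b.1, eval x (sub p) = 0) ∧ ∀ r ∈ b.2, 0 < eval x (sub r)}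
  have hfiber : Y ⁻¹' {q} = ⋃ b ∈ F, S b := by
    ext x
    have h := Set.ext_iff.mp hF (Sum.elim x q)
    simp only [Set.mem_ofPred_eq, Sum.elim_comp_inl, Sum.elim_comp_inr] at h
    rw [Set.mem_preimage, Set.mem_singleton_iff, h]
    simp only [S, hsub, Set.mem_iUnion₂, Set.mem_ofPred_eq, exists_prop]
  have hiso : ∀ x ∈ Y ⁻¹' {q}, ∀ᶠ y in 𝓝 x, y ∈ Y ⁻¹' {q} → y = x := by
    intro x hx
    obtain ⟨e, hxe, rfl⟩ := hloc x
    filter_upwards [e.open_source.mem_nhds hxe] with y hy hyq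
    exact e.injOn hy hxe (hyq.trans hx.symm)
  have hbound : ∀ b ∈ F, (S b).encard ≤ (((2 * (d + 1) - 1) ^ n : ℕ) : ℕ∞) := by
    intro b hb
    have hSb : S b ⊆ Y ⁻¹' {q} := hfiber ▸ Set.subset_biUnion_of_mem (u := S) hb
    have h := encard_isolated_le b.1 b.2 sub sub (d := d) (S := S b) (fun p hp => ?_) rfl
      fun x hx => (hiso x (hSb hx)).mono fun y hy hyS => hy (hSb hyS)
    · simpa using h
    · refine (totalDegree_aeval_le_of_totalDegree_le_one _ (fun i => ?_) p).trans
        ((Finset.le_sup hp).trans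
          (Finset.le_sup (f := fun b : Finset (MvPolynomial (Fin n ⊕ Fin n) ℝ) ×
            Finset (MvPolynomial (Fin n ⊕ Fin n) ℝ) => b.1.sup totalDegree) hb))
      cases i <;> simp
  rw [hfiber]
  refine (F.set_encard_biUnion_le S).trans ((Finset.sum_le_card_nsmul _ _ _ hbound).trans ?_)
  simp
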